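/- For an integrable function $u$ on $\mathbb{R}$ write $\widehat{u}(\xi)=\int_{\mathbb{R}}u(x)e^{-2\pi i\xi x}\,dx$. (1) There is a constant $c>0$ such that for all (complex-valued) $u\in L^1(\mathbb{R})$ $$\big\|\widehat{u}\cdot|\xi|^2\big\|_{L^\infty(\mathbb{R})}^2\cdot\big\|u\cdot|x|^2\big\|_{L^1(\mathbb{R})}^2\;\ge\; c\,\|u\|_{L^1(\mathbb{R})}^4,$$ where the norms on the left may be infinite (and $0\cdot\infty=0$, which occurs only for $u=0$). (2) The triangle function $u_0(x)=\max\{1-|x|,0\}$ is a local extremizer for this inequality with respect to perturbations by symmetric $C^3$ functions supported on $[-1,1]$ with nonnegative Fourier transform, in the following sense. Let $f:\mathbb{R}\to\mathbb{R}$ be even, not identically zero, vanish outside $[-1,1]$, be three times continuously differentiable on $[-1,1]$ (one-sided derivatives at $\pm1$), and satisfy $\widehat{f}(\xi)\ge 0$ for all $\xi\in\mathbb{R}$. Put $$J_f(\varepsilon)=\frac{\big\|\widehat{(u_0+\varepsilon f)}\cdot|\xi|^2\big\|_{L^\infty}^2\cdot\big\|(u_0+\varepsilon f)\cdot|x|^2\big\|_{L^1}^2}{\|u_0+\varepsilon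 f\|_{L^1}^4}.$$ Then $J_f(\varepsilon)$ is finite for all sufficiently small $\varepsilon\ge 0$, the right-hand derivative $J_f'(0^+)=\lim_{\varepsilon\to0^+}\frac{J_f(\varepsilon)-J_f(0)}{\varepsilon}$ exists and is strictly positive, and in particular $J_f(\varepsilon)>J_f(0)$ for all sufficiently small $\varepsilon>0$. -/

import Mathlib

open MeasureTheory Set Filter Topology
open scoped ENNReal FourierTransform

noncomputable section

/-- `‖û · |ξ|²‖_{L^∞(ℝ)}` as an extended nonnegative number, where
`û(ξ) = ∫ u(x) e^{-2πiξx} dx`. -/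
def fourierSecondMomentSup (u : ℝ → ℂ) : ℝ≥0∞ :=
  eLpNorm (fun ξ : ℝ => 𝓕 u ξ * ((|ξ| ^ 2 : ℝ) : ℂ)) ∞ volume

/-- `‖u · |x|²‖_{L¹(ℝ)}` as an extended nonnegative number. -/
def secondMomentNorm (u : ℝ → ℂ) : ℝ≥0∞ :=
  eLpNorm (fun x : ℝ => u x * ((|x| ^ 2 : ℝ) : ℂ)) 1 volume

/-- The quotient `‖û · |ξ|²‖²_{L^∞} · ‖u · |x|²‖²_{L¹} / ‖u‖⁴_{L¹}`. -/
def uncertaintyQuotient (u : ℝ → ℂ) : ℝ≥0∞ :=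
  fourierSecondMomentSup u ^ 2 * secondMomentNorm u ^ 2 / eLpNorm u 1 volume ^ 4

/-- The triangle function: `1 - |x|` on `[-1,1]`, and `0` elsewhere. -/
def triangleFun (x : ℝ) : ℝ := max (1 - |x|) 0

/-- Real symmetric functions supported on `[-1,1]`, of class `C³` on `[-1,1]` (with one-sided
derivatives at the endpoints), with nonnegative Fourier transform. In particular every even `C³`
function on `ℝ` with support in `[-1,1]` and nonnegative Fourier transform qualifies. -/
structure IsAdmissiblePerturbation (f : ℝ → ℝ) : Prop where
  even : ∀ x, f (-x) = f x
  support_subset : Function.support f ⊆ Icc (-1) 1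
  contDiffOn : ContDiffOn ℝ 3 f (Icc (-1) 1)
  fourier_re_nonneg : ∀ ξ : ℝ, 0 ≤ (𝓕 (fun x : ℝ => (f x : ℂ)) ξ).re
  fourier_im_eq_zero : ∀ ξ : ℝ, (𝓕 (fun x : ℝ => (f x : ℂ)) ξ).im = 0

/-- The perturbed triangle function `u₀ + ε f`, regarded as complex valued. -/
def perturbedTriangle (f : ℝ → ℝ) (ε : ℝ) (x : ℝ) : ℂ :=
  ((triangleFun x + ε * f x : ℝ) : ℂ)

/-- The perturbation functional `J_f(ε)`: the quotient evaluated at `u₀ + ε f`. -/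
def perturbationFunctional (f : ℝ → ℝ) (ε : ℝ) : ℝ≥0∞ :=
  uncertaintyQuotient (perturbedTriangle f ε)

end

/-!
Fourier inversion bounds `|u|` almost everywhere by the integral of `|û|`, hence by `‖u‖₁` and
`‖û ξ²‖_∞` with a free frequency scale; integrating this bound over a box, with the second moment
controlling the outside, and optimizing the size of the box gives the inequality.

In the variable `w = 2πξ` the function `4π² ξ² û₀` equals `2 (1 - cos w)`, whose maximum `4` is
attained exactly at the odd multiples of `π`. Since `f̂ ≥ 0`, the boundary terms of the double
integration by parts vanish, so that `ψ = 4π² ξ² f̂` is Lipschitz and tends to `0`. The quadratic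
decay of `2 (1 - cos w)` away from its maxima then makes the right derivative of the supremum of
`2 (1 - cos w) + ε ψ` equal to `G`, the largest value of `ψ` at odd multiples of `π`. Hence
`J_f'(0⁺)` is a positive multiple of `G / 4 + ∫ f (6x² - 2)`. By the cosine series of `6x² - 2` and
`∑_{n odd} n⁻⁴ = π⁴ / 96`, this is a sum with positive weights of the values `ψ(πn)` for even `n`
and `G - ψ(πn)` for odd `n`. All of these are nonnegative, and they vanish together only if `f = 0`.
-/

open scoped Real

section FourierInversion

variable {V E : Type*} [NormedAddCommGroup V] [InnerProductSpace ℝ V] [MeasurableSpace V]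
  [BorelSpace V] [FiniteDimensional ℝ V] [NormedAddCommGroup E] [NormedSpace ℂ E]

theorem norm_fourier_le_integral_norm (u : V → E) (ξ : V) : ‖𝓕 u ξ‖ ≤ ∫ x, ‖u x‖ :=
  VectorFourier.norm_fourierIntegral_le_integral_norm _ _ _ _ _

theorem norm_fourierInv_le_integral_norm (u : V → E) (x : V) : ‖𝓕⁻ u x‖ ≤ ∫ ξ, ‖u ξ‖ := by
  rw [Real.fourierInv_eq_fourier_neg]
  exact norm_fourier_le_integral_norm u _

theorem continuous_fourier {u : V → E} (hu : Integrable u) : Continuous (𝓕 u) :=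
  VectorFourier.fourierIntegral_continuous Real.continuous_fourierChar
    (by exact continuous_inner) hu

theorem continuous_fourierInv {u : V → E} (hu : Integrable u) : Continuous (𝓕⁻ u) := by
  rw [Real.fourierInv_eq_fourier_comp_neg]
  exact continuous_fourier hu.comp_neg

variable [CompleteSpace E]

theorem integral_fourier_smul_eq {φ : V → ℂ} {u : V → E} (hφ : Integrable φ)
    (hu : Integrable u) : ∫ ξ, 𝓕 φ ξ • u ξ = ∫ x, φ x • 𝓕 u x := by
  simpa using! (VectorFourier.integral_fourierIntegral_smul_eq_flip (L := innerₗ V)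
    Real.continuous_fourierChar continuous_inner hφ hu)

theorem integral_fourierInv_smul_eq {φ : V → ℂ} {u : V → E} (hφ : Integrable φ)
    (hu : Integrable u) : ∫ ξ, 𝓕⁻ φ ξ • u ξ = ∫ x, φ x • 𝓕⁻ u x := by
  rw [← integral_neg_eq_self, Real.fourierInv_eq_fourier_comp_neg u]
  simpa only [Real.fourierInv_eq_fourier_neg, neg_neg] using
    integral_fourier_smul_eq hφ hu.comp_neg

theorem ae_eq_fourierInv_fourier {u : V → E} (hu : Integrable u) (hFu : Integrable (𝓕 u)) :
    u =ᵐ[volume] 𝓕⁻ (𝓕 u) := by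
  refine ae_eq_of_integral_contDiff_smul_eq hu.locallyIntegrable
    (continuous_fourierInv hFu).locallyIntegrable fun g hg hg_supp => ?_
  have hgC : ContDiff ℝ (⊤ : ℕ∞) fun x => (g x : ℂ) := Complex.ofRealCLM.contDiff.comp hg
  have hgC_supp : HasCompactSupport fun x => (g x : ℂ) :=
    hg_supp.comp_left (g := fun y : ℝ => (y : ℂ)) Complex.ofReal_zero
  let G : SchwartzMap V ℂ := hgC_supp.toSchwartzMap hgC
  let φ : SchwartzMap V ℂ := 𝓕⁻ G
  have hφ : 𝓕 (φ : V → ℂ) = G := by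
    rw [← SchwartzMap.fourier_coe]
    exact congrArg DFunLike.coe (FourierTransform.fourier_fourierInv_eq G)
  have hgG (x : V) (y : E) : g x • y = G x • y := (Complex.coe_smul (g x) y).symm
  calc ∫ x, g x • u x = ∫ x, 𝓕 (φ : V → ℂ) x • u x := by simp only [hgG, hφ]
    _ = ∫ ξ, φ ξ • 𝓕 u ξ := integral_fourier_smul_eq φ.integrable hu
    _ = ∫ ξ, 𝓕⁻ (G : V → ℂ) ξ • 𝓕 u ξ := by rw [← SchwartzMap.fourierInv_coe]
    _ = ∫ x, G x • 𝓕⁻ (𝓕 u) x := integral_fourierInv_smul_eq G.integrable hFu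
    _ = ∫ x, g x • 𝓕⁻ (𝓕 u) x := by simp only [hgG]

theorem ae_norm_le_integral_norm_fourier {u : V → E} (hu : Integrable u)
    (hFu : Integrable (𝓕 u)) : ∀ᵐ x, ‖u x‖ ≤ ∫ ξ, ‖𝓕 u ξ‖ := by
  filter_upwards [ae_eq_fourierInv_fourier hu hFu] with x hx
  rw [hx]
  exact norm_fourierInv_le_integral_norm _ x

end FourierInversion

section Uncertainty

theorem sq_le_four_mul_of_forall_le_mul_add_div {M a b : ℝ} (hM : 0 ≤ M) (ha : 0 ≤ a)
    (hb : 0 ≤ b) (h : ∀ t, 0 < t → M ≤ a * t + b / t) : M ^ 2 ≤ 4 * a * b := by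
  have hquad (t : ℝ) : 0 ≤ a * (t * t) + -M * t + b := by
    rcases le_or_gt t 0 with ht | ht
    · have := mul_nonneg_of_nonpos_of_nonpos (neg_nonpos.2 hM) ht
      have := mul_nonneg ha (mul_self_nonneg t)
      linarith
    · have := mul_le_mul_of_nonneg_right (h t ht) ht.le
      rw [add_mul, div_mul_cancel₀ _ ht.ne'] at this
      linarith
  have := discrim_le_zero hquad
  rw [discrim, neg_sq] at this
  linarith

variable {E : Type*} [NormedAddCommGroup E] {u : ℝ → E}

theorem integral_norm_le_of_ae_norm_le (hu : Integrable u)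
    (hu2 : Integrable fun x => ‖u x‖ * x ^ 2) {K r : ℝ} (hK : ∀ᵐ x, ‖u x‖ ≤ K) (hr : 0 < r) :
    ∫ x, ‖u x‖ ≤ 2 * r * K + (∫ x, ‖u x‖ * x ^ 2) / r ^ 2 := by
  have hbox : Integrable ((Icc (-r) r).indicator fun _ : ℝ => K) :=
    (integrable_indicator_iff measurableSet_Icc).2 (integrableOn_const (by simp))
  calc ∫ x, ‖u x‖
      ≤ ∫ x, ((Icc (-r) r).indicator (fun _ : ℝ => K) x + ‖u x‖ * x ^ 2 / r ^ 2) := by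
        refine integral_mono_ae hu.norm (hbox.add (hu2.div_const _)) ?_
        filter_upwards [hK] with x hx
        by_cases h : x ∈ Icc (-r) r
        · rw [indicator_of_mem h]
          exact le_add_of_le_of_nonneg hx (by positivity)
        · rw [indicator_of_notMem h, zero_add, le_div_iff₀ (by positivity)]
          rw [mem_Icc, ← abs_le, not_le] at h
          gcongr 1
          exact sq_le_sq.2 ((abs_of_pos hr).trans_le h.le)
    _ = 2 * r * K + (∫ x, ‖u x‖ * x ^ 2) / r ^ 2 := by
        rw [integral_add hbox (hu2.div_const _), integral_indicator_const _ measurableSet_Icc,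
          integral_div, Real.volume_real_Icc_of_le (by linarith), smul_eq_mul]
        ring

variable [NormedSpace ℂ E] [CompleteSpace E]

theorem ae_norm_le_of_fourier_decay (hu : Integrable u) {A s : ℝ} (hs : 0 < s)
    (hA : ∀ᵐ ξ, ‖𝓕 u ξ‖ * ξ ^ 2 ≤ A) : ∀ᵐ x, ‖u x‖ ≤ π * ((∫ x, ‖u x‖) / s + s * A) := by
  set M := ∫ x, ‖u x‖
  have hmaj : ∀ᵐ ξ, ‖𝓕 u ξ‖ ≤ (M + s ^ 2 * A) * (1 + (s * ξ) ^ 2)⁻¹ := by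
    filter_upwards [hA] with ξ hξ
    rw [← div_eq_mul_inv, le_div_iff₀ (by positivity)]
    calc ‖𝓕 u ξ‖ * (1 + (s * ξ) ^ 2) = ‖𝓕 u ξ‖ + s ^ 2 * (‖𝓕 u ξ‖ * ξ ^ 2) := by ring
      _ ≤ M + s ^ 2 * A := by gcongr; exact norm_fourier_le_integral_norm u ξ
  have hmaj_int : Integrable fun ξ : ℝ => (M + s ^ 2 * A) * (1 + (s * ξ) ^ 2)⁻¹ :=
    (integrable_inv_one_add_sq.comp_mul_left' hs.ne').const_mul _
  have hFu : Integrable (𝓕 u) :=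
    hmaj_int.mono' (continuous_fourier hu).aestronglyMeasurable hmaj
  have hval : ∫ ξ : ℝ, (M + s ^ 2 * A) * (1 + (s * ξ) ^ 2)⁻¹ = π * (M / s + s * A) := by
    rw [integral_const_mul, Measure.integral_comp_mul_left (fun x : ℝ => (1 + x ^ 2)⁻¹) s,
      integral_univ_inv_one_add_sq, abs_of_pos (inv_pos.2 hs), smul_eq_mul]
    field_simp
  filter_upwards [ae_norm_le_integral_norm_fourier hu hFu] with x hx
  exact hx.trans ((integral_mono_ae hFu.norm hmaj_int hmaj).trans_eq hval)

theorem sq_integral_norm_le_mul_integral_sq (hu : Integrable u)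
    (hu2 : Integrable fun x => ‖u x‖ * x ^ 2) {A : ℝ} (hA : ∀ᵐ ξ, ‖𝓕 u ξ‖ * ξ ^ 2 ≤ A) :
    (∫ x, ‖u x‖) ^ 2 ≤ 128 * π ^ 2 * (A * ∫ x, ‖u x‖ * x ^ 2) := by
  have hA0 : 0 ≤ A := let ⟨ξ, hξ⟩ := hA.exists; (by positivity : 0 ≤ ‖𝓕 u ξ‖ * ξ ^ 2).trans hξ
  have hsplit (t : ℝ) (ht : 0 < t) :
      ∫ x, ‖u x‖ ≤ 16 * π ^ 2 * A * t + 2 * (∫ x, ‖u x‖ * x ^ 2) / t := by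
    have hr : 0 < √t := Real.sqrt_pos.2 ht
    -- With `s = 4π√t` the mass term of the pointwise bound integrates to half of the mass of `u`.
    have hbound := ae_norm_le_of_fourier_decay hu (s := 4 * π * √t) (by positivity) hA
    have hsplit := integral_norm_le_of_ae_norm_le hu hu2 hbound hr
    have hsimp : 2 * √t * (π * ((∫ x, ‖u x‖) / (4 * π * √t) + 4 * π * √t * A)) =
        (∫ x, ‖u x‖) / 2 + 8 * π ^ 2 * A * √t ^ 2 := by
      field_simp
      ring
    rw [hsimp, Real.sq_sqrt ht.le] at hsplit
    linarith [mul_div_assoc 2 (∫ x, ‖u x‖ * x ^ 2) t]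
  calc (∫ x, ‖u x‖) ^ 2 ≤ 4 * (16 * π ^ 2 * A) * (2 * ∫ x, ‖u x‖ * x ^ 2) :=
        sq_le_four_mul_of_forall_le_mul_add_div (integral_nonneg fun x => norm_nonneg _)
          (by positivity) (by positivity) hsplit
    _ = 128 * π ^ 2 * (A * ∫ x, ‖u x‖ * x ^ 2) := by ring

end Uncertainty

section UncertaintyQuotient

variable {u : ℝ → ℂ}

theorem fourierSecondMomentSup_eq (u : ℝ → ℂ) :
    fourierSecondMomentSup u = eLpNormEssSup (fun ξ : ℝ => ‖𝓕 u ξ‖ * ξ ^ 2) volume := by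
  rw [fourierSecondMomentSup, ← eLpNorm_exponent_top]
  exact eLpNorm_congr_norm_ae (ae_of_all _ fun ξ => by simp)

theorem secondMomentNorm_eq (u : ℝ → ℂ) :
    secondMomentNorm u = eLpNorm (fun x : ℝ => ‖u x‖ * x ^ 2) 1 volume :=
  eLpNorm_congr_norm_ae (ae_of_all _ fun x => by simp)

theorem eLpNorm_one_eq_ofReal_integral_norm {α F : Type*} [MeasurableSpace α] {μ : Measure α}
    [NormedAddCommGroup F] {g : α → F} (hg : Integrable g μ) :
    eLpNorm g 1 μ = ENNReal.ofReal (∫ x, ‖g x‖ ∂μ) := by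
  rw [eLpNorm_one_eq_lintegral_enorm, ofReal_integral_norm_eq_lintegral_enorm hg]

theorem secondMomentNorm_eq_ofReal (hu2 : Integrable fun x => ‖u x‖ * x ^ 2) :
    secondMomentNorm u = ENNReal.ofReal (∫ x, ‖u x‖ * x ^ 2) := by
  rw [secondMomentNorm_eq, eLpNorm_one_eq_ofReal_integral_norm hu2]
  simp only [norm_mul, norm_pow, Real.norm_eq_abs, sq_abs, abs_norm]

theorem aestronglyMeasurable_norm_mul_sq (hu : Integrable u) :
    AEStronglyMeasurable fun x => ‖u x‖ * x ^ 2 :=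
  hu.aestronglyMeasurable.norm.mul (by fun_prop)

theorem integrable_norm_mul_sq (hu : Integrable u) (h : secondMomentNorm u ≠ ∞) :
    Integrable fun x => ‖u x‖ * x ^ 2 :=
  memLp_one_iff_integrable.1
    ⟨aestronglyMeasurable_norm_mul_sq hu, secondMomentNorm_eq u ▸ h.lt_top⟩

theorem ae_norm_fourier_mul_sq_le (h : fourierSecondMomentSup u ≠ ∞) :
    ∀ᵐ ξ, ‖𝓕 u ξ‖ * ξ ^ 2 ≤ (fourierSecondMomentSup u).toReal := by
  filter_upwards [ae_le_eLpNormEssSup (f := fun ξ : ℝ => ‖𝓕 u ξ‖ * ξ ^ 2) (μ := volume)] with ξ hξ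
  rw [← fourierSecondMomentSup_eq] at hξ
  simpa using ENNReal.toReal_mono h hξ

theorem ae_eq_zero_of_ae_mul_sq_eq_zero {g : ℝ → ℂ} (h : ∀ᵐ x, ‖g x‖ * x ^ 2 = 0) :
    g =ᵐ[volume] 0 := by
  filter_upwards [h, Measure.ae_ne volume 0] with x hx hx0
  simpa [hx0] using hx

theorem ae_eq_zero_of_secondMomentNorm_eq_zero (hu : Integrable u) (h : secondMomentNorm u = 0) :
    u =ᵐ[volume] 0 := by
  rw [secondMomentNorm_eq, eLpNorm_eq_zero_iff (aestronglyMeasurable_norm_mul_sq hu)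
    one_ne_zero] at h
  exact ae_eq_zero_of_ae_mul_sq_eq_zero h

theorem ae_eq_zero_of_fourierSecondMomentSup_eq_zero (hu : Integrable u)
    (h : fourierSecondMomentSup u = 0) : u =ᵐ[volume] 0 := by
  rw [fourierSecondMomentSup_eq, eLpNormEssSup_eq_zero_iff] at h
  have hFu : 𝓕 u =ᵐ[volume] 0 := ae_eq_zero_of_ae_mul_sq_eq_zero h
  have hFu_int : Integrable (𝓕 u) := (integrable_zero ℝ ℂ volume).congr hFu.symm
  have hFu_norm : ∫ ξ, ‖𝓕 u ξ‖ = 0 :=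
    integral_eq_zero_of_ae (hFu.mono fun ξ hξ => by simp [hξ])
  filter_upwards [ae_norm_le_integral_norm_fourier hu hFu_int] with x hx
  simpa [hFu_norm] using hx

theorem eLpNorm_one_pow_four_le (hu : Integrable u) :
    ENNReal.ofReal (1 / (128 * π ^ 2) ^ 2) * eLpNorm u 1 volume ^ 4 ≤
      fourierSecondMomentSup u ^ 2 * secondMomentNorm u ^ 2 := by
  by_cases hu0 : u =ᵐ[volume] 0
  · simp [eLpNorm_congr_ae hu0]
  have hA0 := mt (ae_eq_zero_of_fourierSecondMomentSup_eq_zero hu) hu0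
  have hN0 := mt (ae_eq_zero_of_secondMomentNorm_eq_zero hu) hu0
  by_cases hA : fourierSecondMomentSup u = ∞
  · simp [hA, hN0, ENNReal.top_mul]
  by_cases hN : secondMomentNorm u = ∞
  · simp [hN, hA0, ENNReal.mul_top]
  have hu2 := integrable_norm_mul_sq hu hN
  rw [← ENNReal.ofReal_toReal hA, secondMomentNorm_eq_ofReal hu2,
    eLpNorm_one_eq_ofReal_integral_norm hu]
  set A := (fourierSecondMomentSup u).toReal
  rw [← ENNReal.ofReal_pow (by positivity), ← ENNReal.ofReal_pow (by positivity),
    ← ENNReal.ofReal_pow (by positivity), ← ENNReal.ofReal_mul (by positivity),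
    ← ENNReal.ofReal_mul (by positivity)]
  refine ENNReal.ofReal_le_ofReal ?_
  rw [one_div, inv_mul_le_iff₀ (by positivity)]
  calc (∫ x, ‖u x‖) ^ 4 = ((∫ x, ‖u x‖) ^ 2) ^ 2 := by ring
    _ ≤ (128 * π ^ 2 * (A * ∫ x, ‖u x‖ * x ^ 2)) ^ 2 := by
      gcongr
      exact sq_integral_norm_le_mul_integral_sq hu hu2 (ae_norm_fourier_mul_sq_le hA)
    _ = (128 * π ^ 2) ^ 2 * (A ^ 2 * (∫ x, ‖u x‖ * x ^ 2) ^ 2) := by ring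

end UncertaintyQuotient

section CosTransform

/-- The cosine transform of the restriction of `h` to `[-1, 1]`. The angular frequency `w`
corresponds to the frequency `ξ = w / 2π` of `𝓕`. -/
noncomputable def cosTransform (h : ℝ → ℝ) (w : ℝ) : ℝ :=
  ∫ x in (-1 : ℝ)..1, h x * Real.cos (w * x)

variable {h : ℝ → ℝ}

theorem intervalIntegrable_mul_of_continuousOn {g : ℝ → ℝ} (hh : ContinuousOn h (Icc (-1) 1))
    (hg : Continuous g) : IntervalIntegrable (fun x => h x * g x) volume (-1) 1 := by
  refine ContinuousOn.intervalIntegrable ?_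
  rw [uIcc_of_le (by norm_num)]
  exact hh.mul hg.continuousOn

theorem re_fourier_indicator_eq_cosTransform (hh : ContinuousOn h (Icc (-1) 1)) (ξ : ℝ) :
    (𝓕 ((Icc (-1) 1).indicator fun x => (h x : ℂ)) ξ).re = cosTransform h (2 * π * ξ) := by
  let e : ℝ → ℂ := fun x => Complex.exp (↑(-2 * π * x * ξ) * Complex.I)
  have he : Continuous e := by fun_prop
  have hint : IntegrableOn (fun x => e x • (h x : ℂ)) (Icc (-1) 1) :=
    (he.continuousOn.smul (Complex.continuous_ofReal.comp_continuousOn hh)).integrableOn_Icc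
  have hfourier : 𝓕 ((Icc (-1) 1).indicator fun x => (h x : ℂ)) ξ =
      ∫ x, (Icc (-1) 1).indicator (fun x => e x • (h x : ℂ)) x := by
    rw [Real.fourier_real_eq_integral_exp_smul]
    exact integral_congr_ae (ae_of_all _ fun x => (indicator_smul_apply _ e _ x).symm)
  rw [hfourier, integral_indicator measurableSet_Icc, ← RCLike.re_eq_complex_re, ← integral_re hint,
    integral_Icc_eq_integral_Ioc, cosTransform, intervalIntegral.integral_of_le (by norm_num)]
  congr with x
  rw [RCLike.re_eq_complex_re, smul_eq_mul, Complex.re_mul_ofReal, Complex.exp_ofReal_mul_I_re,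
    mul_comm, ← Real.cos_neg]
  congr 2
  ring

theorem fourier_ofReal_im_eq_zero_of_even (heven : ∀ x, h (-x) = h x) (ξ : ℝ) :
    (𝓕 (fun x => (h x : ℂ)) ξ).im = 0 := by
  rw [← Complex.conj_eq_iff_im, Real.fourier_real_eq_integral_exp_smul, ← integral_conj,
    ← integral_neg_eq_self]
  congr with x
  simp only [smul_eq_mul, map_mul, Complex.conj_ofReal, heven, ← Complex.exp_conj, Complex.conj_I]
  congr 2
  push_cast
  ring

theorem fourier_ofReal_eq_cosTransform (heven : ∀ x, h (-x) = h x)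
    (hsupp : Function.support h ⊆ Icc (-1) 1) (hh : ContinuousOn h (Icc (-1) 1)) (ξ : ℝ) :
    𝓕 (fun x => (h x : ℂ)) ξ = cosTransform h (2 * π * ξ) := by
  refine Complex.ext ?_ (fourier_ofReal_im_eq_zero_of_even heven ξ)
  rw [Complex.ofReal_re, ← re_fourier_indicator_eq_cosTransform hh, indicator_eq_self.2]
  exact fun x hx => hsupp fun h0 => hx (by simp [h0])

theorem tendsto_cosTransform_cocompact (hh : ContinuousOn h (Icc (-1) 1)) :
    Tendsto (cosTransform h) (cocompact ℝ) (𝓝 0) := by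
  have hscale : Tendsto (fun w : ℝ => (2 * π)⁻¹ * w) (cocompact ℝ) (cocompact ℝ) :=
    tendsto_cocompact_mul_left₀ (by positivity)
  have hRL := (Complex.continuous_re.tendsto 0).comp
    ((Real.zero_at_infty_fourier ((Icc (-1) 1).indicator fun x => (h x : ℂ))).comp hscale)
  rw [Complex.zero_re] at hRL
  refine hRL.congr fun w => ?_
  simp only [Function.comp_apply]
  rw [re_fourier_indicator_eq_cosTransform hh, mul_inv_cancel_left₀ (by positivity)]

theorem exists_lipschitzWith_cosTransform (hh : ContinuousOn h (Icc (-1) 1)) :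
    ∃ L, LipschitzWith L (cosTransform h) := by
  obtain ⟨C, hC⟩ := isCompact_Icc.exists_bound_of_continuousOn hh
  have hC0 : 0 ≤ C := (norm_nonneg _).trans (hC 0 (by simp))
  have hint (w : ℝ) := intervalIntegrable_mul_of_continuousOn hh
    (g := fun x => Real.cos (w * x)) (by fun_prop)
  refine ⟨_, LipschitzWith.of_dist_le_mul (K := (C * 2).toNNReal) fun w w' => ?_⟩
  rw [Real.dist_eq, Real.dist_eq, cosTransform, cosTransform,
    ← intervalIntegral.integral_sub (hint w) (hint w'), Real.coe_toNNReal _ (by positivity)]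
  have hbound : ∀ x ∈ uIoc (-1 : ℝ) 1,
      ‖h x * Real.cos (w * x) - h x * Real.cos (w' * x)‖ ≤ C * |w - w'| := by
    intro x hx
    rw [uIoc_of_le (by norm_num)] at hx
    rw [← mul_sub, norm_mul, Real.norm_eq_abs (_ - _)]
    refine mul_le_mul (hC x (Ioc_subset_Icc_self hx)) ?_ (abs_nonneg _) hC0
    calc |Real.cos (w * x) - Real.cos (w' * x)| ≤ |w * x - w' * x| := Real.abs_cos_sub_cos_le _ _
      _ = |w - w'| * |x| := by rw [← sub_mul, abs_mul]
      _ ≤ |w - w'| := mul_le_of_le_one_right (abs_nonneg _) (abs_le.2 (Ioc_subset_Icc_self hx))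
  refine (intervalIntegral.norm_integral_le_of_norm_le_const hbound).trans_eq ?_
  norm_num
  ring

theorem sq_mul_cosTransform {h₁ h₂ : ℝ → ℝ} (hh : ContinuousOn h (Icc (-1) 1))
    (hh₁ : ContinuousOn h₁ (Icc (-1) 1)) (hh₂ : ContinuousOn h₂ (Icc (-1) 1))
    (hderiv : ∀ x ∈ Ioo (-1 : ℝ) 1, HasDerivAt h (h₁ x) x)
    (hderiv₁ : ∀ x ∈ Ioo (-1 : ℝ) 1, HasDerivAt h₁ (h₂ x) x) (w : ℝ) :
    w ^ 2 * cosTransform h w = w * Real.sin w * (h 1 + h (-1)) +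
      Real.cos w * (h₁ 1 - h₁ (-1)) - cosTransform h₂ w := by
  have hint := intervalIntegrable_mul_of_continuousOn hh
    (g := fun x => Real.cos (w * x)) (by fun_prop)
  have hint₂ := intervalIntegrable_mul_of_continuousOn hh₂
    (g := fun x => Real.cos (w * x)) (by fun_prop)
  have hftc := intervalIntegral.integral_eq_sub_of_hasDerivAt_of_le (a := -1) (b := 1)
    (f := fun x => w * (h x * Real.sin (w * x)) + h₁ x * Real.cos (w * x))
    (f' := fun x => w ^ 2 * (h x * Real.cos (w * x)) + h₂ x * Real.cos (w * x))
    (by norm_num) (by fun_prop) (fun x hx => by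
      have hw : HasDerivAt (fun x : ℝ => w * x) w x := by
        simpa using (hasDerivAt_id x).const_mul w
      refine ((((hderiv x hx).mul hw.sin).const_mul w).add
        ((hderiv₁ x hx).mul hw.cos)).congr_deriv ?_
      ring) ((hint.const_mul _).add hint₂)
  rw [intervalIntegral.integral_add (hint.const_mul _) hint₂,
    intervalIntegral.integral_const_mul] at hftc
  simp only [mul_one, mul_neg, Real.sin_neg, Real.cos_neg] at hftc
  rw [cosTransform, cosTransform]
  linarith

theorem exists_contDiffOn_hasDerivAt {F : Type*} [NormedAddCommGroup F] [NormedSpace ℝ F]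
    {g : ℝ → F} {a b : ℝ} (hab : a < b) {n : ℕ} (hg : ContDiffOn ℝ (n + 1) g (Icc a b)) :
    ∃ g' : ℝ → F, ContDiffOn ℝ n g' (Icc a b) ∧ ∀ x ∈ Ioo a b, HasDerivAt g (g' x) x := by
  refine ⟨derivWithin g (Icc a b), hg.derivWithin (uniqueDiffOn_Icc hab) le_rfl, fun x hx => ?_⟩
  have hdiff : DifferentiableWithinAt ℝ g (Icc a b) x :=
    hg.differentiableOn (by simp) x (Ioo_subset_Icc_self hx)
  exact hdiff.hasDerivWithinAt.hasDerivAt (Icc_mem_nhds hx.1 hx.2)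

end CosTransform

section Oscillation

variable {e : ℝ → ℝ} {a b : ℝ}

theorem nonneg_of_forall_le_along_period (he : Tendsto e atTop (𝓝 0)) (θ : ℝ)
    (h : ∀ n : ℕ, e (θ + n * (2 * π)) ≤ b) : 0 ≤ b :=
  le_of_tendsto' (he.comp (tendsto_atTop_add_const_left _ θ
    (tendsto_natCast_atTop_atTop.atTop_mul_const Real.two_pi_pos))) h

theorem eq_zero_of_forall_le_mul_sin_add_mul_cos (he : Tendsto e atTop (𝓝 0))
    (h : ∀ w, e w ≤ w * Real.sin w * a + Real.cos w * b) : a = 0 ∧ b = 0 := by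
  have hdiv : Tendsto (fun w => e w / w) atTop (𝓝 0) := he.div_atTop tendsto_id
  have ha : a = 0 := by
    refine le_antisymm ?_ (nonneg_of_forall_le_along_period hdiv (π / 2) fun n => ?_)
    · refine neg_nonneg.1 (nonneg_of_forall_le_along_period hdiv (π / 2 + π) fun n => ?_)
      rw [div_le_iff₀ (by positivity)]
      simpa [Real.sin_add_pi, Real.cos_add_pi, mul_comm a, -neg_add_rev] using
        h (π / 2 + π + n * (2 * π))
    · rw [div_le_iff₀ (by positivity)]
      simpa [mul_comm a] using h (π / 2 + n * (2 * π))
  subst ha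
  refine ⟨rfl, le_antisymm ?_ (nonneg_of_forall_le_along_period he 0 fun n => ?_)⟩
  · refine neg_nonneg.1 (nonneg_of_forall_le_along_period he π fun n => ?_)
    simpa using h (π + n * (2 * π))
  · simpa using h (0 + n * (2 * π))

end Oscillation

section Perturbation

/-- The hypotheses of `IsAdmissiblePerturbation` with two derivatives in place of three, and with
nonnegativity of the Fourier transform imposed on its real part only. -/
structure IsC2AdmissiblePerturbation (f : ℝ → ℝ) : Prop where
  even : ∀ x, f (-x) = f x
  support_subset : Function.support f ⊆ Icc (-1) 1
  contDiffOn : ContDiffOn ℝ 2 f (Icc (-1) 1)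
  fourier_re_nonneg : ∀ ξ : ℝ, 0 ≤ (𝓕 (fun x : ℝ => (f x : ℂ)) ξ).re

theorem IsAdmissiblePerturbation.isC2AdmissiblePerturbation {f : ℝ → ℝ}
    (hf : IsAdmissiblePerturbation f) : IsC2AdmissiblePerturbation f where
  even := hf.even
  support_subset := hf.support_subset
  contDiffOn := hf.contDiffOn.of_le (by norm_num)
  fourier_re_nonneg := hf.fourier_re_nonneg

/-- The weighted transform `w² ∫ f(x) cos(wx) dx`, which is `4π² ξ² f̂(ξ)` at `w = 2πξ`. -/
noncomputable def weightedCosTransform (f : ℝ → ℝ) (w : ℝ) : ℝ :=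
  w ^ 2 * cosTransform f w

namespace IsC2AdmissiblePerturbation

variable {f : ℝ → ℝ} (hf : IsC2AdmissiblePerturbation f)

include hf

theorem continuousOn : ContinuousOn f (Icc (-1) 1) :=
  hf.contDiffOn.continuousOn

theorem fourier_eq_cosTransform (ξ : ℝ) : 𝓕 (fun x => (f x : ℂ)) ξ = cosTransform f (2 * π * ξ) :=
  fourier_ofReal_eq_cosTransform hf.even hf.support_subset hf.continuousOn ξ

theorem weightedCosTransform_nonneg (w : ℝ) : 0 ≤ weightedCosTransform f w := by
  have h := hf.fourier_re_nonneg (w / (2 * π))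
  rw [hf.fourier_eq_cosTransform, Complex.ofReal_re, mul_div_cancel₀ _ (by positivity)] at h
  exact mul_nonneg (sq_nonneg w) h

/-- Nonnegativity of the transform rules out the oscillating boundary terms of the double
integration by parts. -/
theorem exists_weightedCosTransform_eq_neg_cosTransform :
    f 1 = 0 ∧ ∃ f₂, ContinuousOn f₂ (Icc (-1) 1) ∧
      ∀ w, weightedCosTransform f w = -cosTransform f₂ w := by
  obtain ⟨f₁, hf₁, hderiv⟩ := exists_contDiffOn_hasDerivAt (n := 1) (by norm_num) hf.contDiffOn
  obtain ⟨f₂, hf₂, hderiv₁⟩ := exists_contDiffOn_hasDerivAt (n := 0) (by norm_num) hf₁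
  have hparts (w : ℝ) : weightedCosTransform f w = _ :=
    sq_mul_cosTransform hf.continuousOn hf₁.continuousOn hf₂.continuousOn hderiv hderiv₁ w
  obtain ⟨ha, hb⟩ := eq_zero_of_forall_le_mul_sin_add_mul_cos
    (a := f 1 + f (-1)) (b := f₁ 1 - f₁ (-1))
    ((tendsto_cosTransform_cocompact hf₂.continuousOn).mono_left atTop_le_cocompact) fun w => by
      linarith [hparts w, hf.weightedCosTransform_nonneg w]
  refine ⟨by linarith [hf.even 1], f₂, hf₂.continuousOn, fun w => ?_⟩
  rw [hparts, ha, hb]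
  ring

theorem exists_lipschitzWith_weightedCosTransform :
    ∃ L, LipschitzWith L (weightedCosTransform f) := by
  obtain ⟨-, f₂, hf₂, heq⟩ := hf.exists_weightedCosTransform_eq_neg_cosTransform
  obtain ⟨L, hL⟩ := exists_lipschitzWith_cosTransform hf₂
  exact ⟨L, (funext heq : weightedCosTransform f = _) ▸ hL.neg⟩

theorem tendsto_weightedCosTransform_cocompact :
    Tendsto (weightedCosTransform f) (cocompact ℝ) (𝓝 0) := by
  obtain ⟨-, f₂, hf₂, heq⟩ := hf.exists_weightedCosTransform_eq_neg_cosTransform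
  rw [funext heq, ← neg_zero]
  exact (tendsto_cosTransform_cocompact hf₂).neg

theorem tendsto_weightedCosTransform_odd_mul_pi :
    Tendsto (fun k : ℤ => weightedCosTransform f ((2 * k + 1) * π)) (cocompact ℤ) (𝓝 0) := by
  have hodd : IsClosedEmbedding fun k : ℤ => 2 * π * k + π :=
    (affineHomeomorph (2 * π) π (by positivity)).isClosedEmbedding.comp
      Int.isClosedEmbedding_coe_real
  refine (hf.tendsto_weightedCosTransform_cocompact.comp hodd.tendsto_cocompact).congr fun k => ?_
  rw [Function.comp_apply, show 2 * π * k + π = (2 * k + 1) * π by ring]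

theorem exists_forall_weightedCosTransform_odd_mul_pi_le :
    ∃ k : ℤ, ∀ j : ℤ,
      weightedCosTransform f ((2 * j + 1) * π) ≤ weightedCosTransform f ((2 * k + 1) * π) := by
  by_cases h0 : ∃ k : ℤ, 0 < weightedCosTransform f ((2 * k + 1) * π)
  · obtain ⟨k₀, hk₀⟩ := h0
    exact continuous_of_discreteTopology.exists_forall_ge' k₀
      ((hf.tendsto_weightedCosTransform_odd_mul_pi.eventually_lt_const hk₀).mono fun _ => le_of_lt)
  · push Not at h0
    exact ⟨0, fun j => (h0 j).trans (hf.weightedCosTransform_nonneg _)⟩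

end IsC2AdmissiblePerturbation

end Perturbation

section CosineSeries

variable {h : ℝ → ℝ}

theorem hasSum_mul_cosTransform {ι : Type*} [Countable ι] {c w : ι → ℝ} {g : ℝ → ℝ}
    (hc : Summable c)
    (hg : ∀ x ∈ Icc (-1 : ℝ) 1, HasSum (fun i => c i * Real.cos (w i * x)) (g x))
    (hh : ContinuousOn h (Icc (-1) 1)) :
    HasSum (fun i => c i * cosTransform h (w i)) (∫ x in (-1 : ℝ)..1, h x * g x) := by
  obtain ⟨C, hC⟩ := isCompact_Icc.exists_bound_of_continuousOn hh
  have hIoc : uIoc (-1 : ℝ) 1 = Ioc (-1) 1 := uIoc_of_le (by norm_num)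
  simp_rw [cosTransform, ← intervalIntegral.integral_const_mul]
  refine intervalIntegral.hasSum_integral_of_dominated_convergence (fun i _ => |c i| * C)
    (fun i => ?_) (fun i => ae_of_all _ fun x hx => ?_)
    (ae_of_all _ fun _ _ => hc.abs.mul_right C) (by simp) (ae_of_all _ fun x hx => ?_)
  · exact ((intervalIntegrable_mul_of_continuousOn hh
      (g := fun x => Real.cos (w i * x)) (by fun_prop)).const_mul _).def'.aestronglyMeasurable
  · have hx' : x ∈ Icc (-1 : ℝ) 1 := Ioc_subset_Icc_self (hIoc ▸ hx)
    rw [norm_mul, norm_mul, Real.norm_eq_abs (c i)]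
    gcongr
    exact (mul_le_of_le_one_right (norm_nonneg _) (Real.abs_cos_le_one _)).trans (hC x hx')
  · simpa only [mul_left_comm] using (hg x (Ioc_subset_Icc_self (hIoc ▸ hx))).mul_left (h x)

/-- The cosine coefficients of `6x² - 2` on `[-1, 1]`. At `n = 0` the division by zero returns the
correct value `0`. -/
noncomputable def parabolaCoeff (n : ℕ) : ℝ :=
  24 * (-1) ^ n / (π ^ 2 * n ^ 2)

theorem hasSum_parabolaCoeff_mul_cos {x : ℝ} (hx : x ∈ Icc (-1 : ℝ) 1) :
    HasSum (fun n : ℕ => parabolaCoeff n * Real.cos (π * n * x)) (6 * x ^ 2 - 2) := by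
  have hbernoulli := (hasSum_one_div_nat_pow_mul_cos one_ne_zero (x := (x + 1) / 2)
    ⟨by linarith [hx.1], by linarith [hx.2]⟩).mul_left (24 / π ^ 2)
  have hB₂ : (Polynomial.map (algebraMap ℚ ℝ) (Polynomial.bernoulli (2 * 1))).eval ((x + 1) / 2) =
      (x ^ 2 - 1) / 4 + 1 / 6 := by
    rw [mul_one, Polynomial.bernoulli_def]
    simp [Finset.sum_range_succ, bernoulli_eq_bernoulli'_of_ne_one, bernoulli_one]
    ring
  have hcos (n : ℕ) : Real.cos (2 * π * n * ((x + 1) / 2)) = (-1) ^ n * Real.cos (π * n * x) := by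
    rw [← Real.cos_add_nat_mul_pi]
    ring_nf
  simp_rw [hcos, hB₂] at hbernoulli
  convert! hbernoulli using 1
  · ext n
    rw [parabolaCoeff, mul_one]
    field_simp
  · norm_num
    field_simp
    ring

theorem summable_parabolaCoeff : Summable parabolaCoeff := by
  simpa using! (hasSum_parabolaCoeff_mul_cos (x := 0) (by simp)).summable

theorem hasSum_one_sub_neg_one_pow_div_pow_four :
    HasSum (fun n : ℕ => (1 - (-1) ^ n) / 2 * (1 / (n : ℝ) ^ 4)) (π ^ 4 / 96) := by
  have halternating := hasSum_one_div_nat_pow_mul_cos two_ne_zero (x := 1 / 2) (by norm_num)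
  have hB₄ : (Polynomial.map (algebraMap ℚ ℝ) (Polynomial.bernoulli (2 * 2))).eval (1 / 2) =
      7 / 240 := by
    rw [Polynomial.bernoulli_def]
    simp [Finset.sum_range_succ, bernoulli_eq_bernoulli'_of_ne_one, bernoulli_one, bernoulli'_three,
      bernoulli'_four, Nat.choose]
    norm_num
  have hcos (n : ℕ) : Real.cos (2 * π * n * (1 / 2)) = (-1) ^ n := by
    rw [← Real.cos_nat_mul_pi]
    ring_nf
  simp_rw [hcos, hB₄] at halternating
  convert! (hasSum_zeta_four.sub halternating).div_const 2 using 1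
  · ext n
    ring
  · norm_num [Nat.factorial]
    ring

theorem eq_fourierCoeff_zero_of_fourierCoeff_eq_zero {T : ℝ} [Fact (0 < T)]
    {φ : C(AddCircle T, ℂ)} (hφ : ∀ n ≠ 0, fourierCoeff φ n = 0)
    (z : AddCircle T) : φ z = fourierCoeff φ 0 := by
  have hsummable : Summable (fourierCoeff φ) :=
    summable_of_ne_finset_zero (s := {0}) fun n hn => hφ n (by simpa using hn)
  refine (has_pointwise_sum_fourier_series_of_summable hsummable z).unique ?_
  simpa using hasSum_single (f := fun n => fourierCoeff φ n • fourier n z) 0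
    fun n hn => by simp [hφ n hn]

theorem fourierCoeff_liftIco_eq_cosTransform [Fact ((0 : ℝ) < 2)] (heven : ∀ x, h (-x) = h x)
    (hh : ContinuousOn h (Icc (-1) 1)) (n : ℤ) :
    fourierCoeff (AddCircle.liftIco 2 (-1) fun x => (h x : ℂ)) n =
      cosTransform h (π * n) / 2 := by
  let e : ℝ → ℂ := fun x => Complex.exp (-(π * n * x) * Complex.I) * h x
  have he : IntervalIntegrable e volume (-1) 1 := by
    refine ContinuousOn.intervalIntegrable ?_
    rw [uIcc_of_le (by norm_num)]
    exact (Continuous.continuousOn (by fun_prop)).mul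
      (Complex.continuous_ofReal.comp_continuousOn hh)
  have hreflect : ∫ x in (-1 : ℝ)..1, e (-x) = ∫ x in (-1 : ℝ)..1, e x := by
    rw [intervalIntegral.integral_comp_neg, neg_neg]
  have he' : IntervalIntegrable (fun x => e (-x)) volume (-1) 1 := by
    simpa using (IntervalIntegrable.iff_comp_neg).1 (IntervalIntegrable.symm he)
  have hcos : 2 * ∫ x in (-1 : ℝ)..1, e x = 2 * cosTransform h (π * n) := by
    rw [two_mul, ← hreflect]
    nth_rw 2 [hreflect]
    rw [← intervalIntegral.integral_add he' he, cosTransform, ← intervalIntegral.integral_ofReal,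
      ← intervalIntegral.integral_const_mul]
    congr with x
    simp only [e, heven]
    push_cast
    rw [Complex.cos]
    ring_nf
  rw [fourierCoeff_liftIco_eq, fourierCoeffOn_eq_integral,
    ← mul_left_cancel₀ two_ne_zero hcos]
  have hkernel (x : ℝ) :
      fourier (-n) (x : AddCircle (-1 + 2 - -1 : ℝ)) • (h x : ℂ) = e x := by
    rw [fourier_coe_apply, smul_eq_mul]
    congr 2
    push_cast
    ring
  simp_rw [hkernel]
  rw [show (-1 : ℝ) + 2 = 1 by norm_num, Complex.real_smul]
  norm_num
  ring

theorem eq_of_cosTransform_eq_zero (heven : ∀ x, h (-x) = h x)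
    (hh : ContinuousOn h (Icc (-1) 1)) (hzero : ∀ n : ℕ, n ≠ 0 → cosTransform h (π * n) = 0)
    {x y : ℝ} (hx : x ∈ Icc (-1 : ℝ) 1) (hy : y ∈ Icc (-1 : ℝ) 1) : h x = h y := by
  have : Fact ((0 : ℝ) < 2) := ⟨two_pos⟩
  have hend : (-1 : ℝ) + 2 = 1 := by norm_num
  let φ : C(AddCircle (2 : ℝ), ℂ) := ⟨AddCircle.liftIco 2 (-1) fun x => (h x : ℂ),
    AddCircle.liftIco_continuous (by simp [hend, heven])
      (by rw [hend]; exact Complex.continuous_ofReal.comp_continuousOn hh)⟩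
  have hcoeff (n : ℤ) (hn : n ≠ 0) : fourierCoeff φ n = 0 := by
    refine (fourierCoeff_liftIco_eq_cosTransform heven hh n).trans ?_
    have habs : cosTransform h (π * n) = cosTransform h (π * n.natAbs) := by
      rcases Int.natAbs_eq n with hn' | hn' <;> rw [hn'] <;> simp [cosTransform]
    rw [habs, hzero n.natAbs (by simpa using hn), Complex.ofReal_zero, zero_div]
  have hconst (x : ℝ) (hx : x ∈ Icc (-1 : ℝ) 1) : (h x : ℂ) = fourierCoeff φ 0 := by
    have hIco (x : ℝ) (hx : x ∈ Ico (-1 : ℝ) 1) : (h x : ℂ) = fourierCoeff φ 0 := by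
      rw [← eq_fourierCoeff_zero_of_fourierCoeff_eq_zero hcoeff x]
      exact (AddCircle.liftIco_coe_apply (f := fun x => (h x : ℂ)) (by rwa [hend])).symm
    rcases hx.2.lt_or_eq with hlt | rfl
    · exact hIco x ⟨hx.1, hlt⟩
    · rw [← heven]
      exact hIco (-1) (by norm_num)
  exact_mod_cast (hconst x hx).trans (hconst y hy).symm

end CosineSeries

section MomentInequality

/-- The gap at `πn` between the weighted cosine transform and its bounds: the lower bound `0` at
even multiples of `π`, the upper bound `G` at odd ones. -/
noncomputable def parityGap (f : ℝ → ℝ) (G : ℝ) (n : ℕ) : ℝ :=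
  if Even n then weightedCosTransform f (π * n) else G - weightedCosTransform f (π * n)

theorem hasSum_parityGap {f : ℝ → ℝ} (hf : ContinuousOn f (Icc (-1) 1)) (G : ℝ) :
    HasSum (fun n : ℕ => 24 / (π ^ 4 * n ^ 4) * parityGap f G n)
      (G / 4 + ∫ x in (-1 : ℝ)..1, f x * (6 * x ^ 2 - 2)) := by
  convert! (hasSum_one_sub_neg_one_pow_div_pow_four.mul_left (24 * G / π ^ 4)).add
    (hasSum_mul_cosTransform summable_parabolaCoeff (fun _ => hasSum_parabolaCoeff_mul_cos) hf)
    using 1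
  · ext n
    rcases eq_or_ne n 0 with rfl | hn
    · simp [parabolaCoeff]
    rw [parityGap, weightedCosTransform, parabolaCoeff]
    rcases n.even_or_odd with h | h
    · rw [if_pos h, h.neg_one_pow]
      field_simp
      ring
    · rw [if_neg (Nat.not_even_iff_odd.2 h), h.neg_one_pow]
      field_simp
      ring
  · field_simp
    ring

namespace IsC2AdmissiblePerturbation

variable {f : ℝ → ℝ} {G : ℝ} (hf : IsC2AdmissiblePerturbation f)

include hf

theorem parityGap_nonneg (hG : ∀ n : ℕ, Odd n → weightedCosTransform f (π * n) ≤ G) (n : ℕ) :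
    0 ≤ parityGap f G n := by
  rw [parityGap]
  split_ifs with h
  · exact hf.weightedCosTransform_nonneg _
  · exact sub_nonneg.2 (hG n (Nat.not_even_iff_odd.1 h))

theorem eq_zero_of_parityGap_eq_zero (hgap : ∀ n : ℕ, n ≠ 0 → parityGap f G n = 0) : f = 0 := by
  have hodd (n : ℕ) (hn : Odd n) : weightedCosTransform f (π * n) = G := by
    have h := hgap n hn.pos.ne'
    rw [parityGap, if_neg (Nat.not_even_iff_odd.2 hn)] at h
    linarith
  have hG : G = 0 := by
    have hfreq : Tendsto (fun n : ℕ => π * (2 * n + 1 : ℕ)) atTop (cocompact ℝ) := by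
      refine Tendsto.mono_right ?_ atTop_le_cocompact
      refine (tendsto_natCast_atTop_atTop.comp ?_).const_mul_atTop Real.pi_pos
      exact tendsto_atTop_mono (fun n => by dsimp only [id]; omega) tendsto_id
    refine tendsto_nhds_unique ?_ (hf.tendsto_weightedCosTransform_cocompact.comp hfreq)
    exact tendsto_const_nhds.congr fun n => (hodd _ ⟨n, rfl⟩).symm
  have hcoeff (n : ℕ) (hn : n ≠ 0) : cosTransform f (π * n) = 0 := by
    have h : weightedCosTransform f (π * n) = 0 := by
      rcases n.even_or_odd with h | h
      · simpa only [parityGap, if_pos h] using hgap n hn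
      · rw [hodd n h, hG]
    exact (mul_eq_zero.1 h).resolve_left (by positivity)
  ext x
  by_cases hx : x ∈ Icc (-1 : ℝ) 1
  · exact (eq_of_cosTransform_eq_zero hf.even hf.continuousOn hcoeff hx (by simp)).trans
      hf.exists_weightedCosTransform_eq_neg_cosTransform.1
  · exact Function.notMem_support.1 fun h => hx (hf.support_subset h)

theorem quarter_add_integral_pos (hne : f ≠ 0)
    (hG : ∀ n : ℕ, Odd n → weightedCosTransform f (π * n) ≤ G) :
    0 < G / 4 + ∫ x in (-1 : ℝ)..1, f x * (6 * x ^ 2 - 2) := by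
  have hsum := hasSum_parityGap hf.continuousOn G
  have hterm (n : ℕ) : 0 ≤ 24 / (π ^ 4 * n ^ 4) * parityGap f G n :=
    mul_nonneg (by positivity) (hf.parityGap_nonneg hG n)
  refine (hsum.nonneg hterm).lt_of_ne fun heq => hne ?_
  rw [← heq, hasSum_zero_iff_of_nonneg hterm] at hsum
  exact hf.eq_zero_of_parityGap_eq_zero fun n hn =>
    (mul_eq_zero.1 (congrFun hsum n)).resolve_left (by positivity)

end IsC2AdmissiblePerturbation

end MomentInequality

section OneSidedCalculus

variable {g : ℝ → ℝ} {d x : ℝ}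

theorem hasDerivWithinAt_of_le_of_le {l u : ℝ → ℝ} {s : Set ℝ} (hl : HasDerivWithinAt l d s x)
    (hu : HasDerivWithinAt u d s x) (hlg : ∀ y ∈ s, l y ≤ g y) (hgu : ∀ y ∈ s, g y ≤ u y)
    (hlx : l x = g x) (hux : u x = g x) : HasDerivWithinAt g d s x := by
  rw [hasDerivWithinAt_iff_isLittleO] at hl hu ⊢
  refine (Asymptotics.IsBigO.of_bound 1 ?_).trans_isLittleO (hl.norm_left.add hu.norm_left)
  filter_upwards [self_mem_nhdsWithin] with y hy
  simp only [Real.norm_eq_abs, one_mul, hlx, hux]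
  have hlower : l y - g x - (y - x) • d ≤ g y - g x - (y - x) • d := by gcongr; exact hlg y hy
  have hupper : g y - g x - (y - x) • d ≤ u y - g x - (y - x) • d := by gcongr; exact hgu y hy
  calc |g y - g x - (y - x) • d|
    _ ≤ max |l y - g x - (y - x) • d| |u y - g x - (y - x) • d| :=
      abs_le_max_abs_abs hlower hupper
    _ ≤ |l y - g x - (y - x) • d| + |u y - g x - (y - x) • d| :=
      max_le_add_of_nonneg (abs_nonneg _) (abs_nonneg _)
    _ ≤ _ := le_abs_self _

theorem eventually_lt_of_hasDerivWithinAt_Ici_pos (hg : HasDerivWithinAt g d (Ici x) x)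
    (hd : 0 < d) : ∀ᶠ y in 𝓝[>] x, g x < g y := by
  have hslope := (hasDerivWithinAt_iff_tendsto_slope' self_notMem_Ioi).1 hg.Ioi_of_Ici
  filter_upwards [hslope.eventually_const_lt hd, self_mem_nhdsWithin] with y hy hxy
  rwa [slope_def_field, div_pos_iff_of_pos_right (sub_pos.2 hxy), sub_pos] at hy

end OneSidedCalculus

section SpectralPeak

theorem ofReal_le_eLpNormEssSup {α : Type*} [TopologicalSpace α] [MeasurableSpace α]
    {μ : Measure α} [μ.IsOpenPosMeasure] {q : α → ℝ} (hq : Continuous q) (y : α) :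
    ENNReal.ofReal (q y) ≤ eLpNormEssSup q μ := by
  by_contra! hlt
  have hopen : IsOpen {z | eLpNormEssSup q μ < ENNReal.ofReal (q z)} :=
    isOpen_lt continuous_const (ENNReal.continuous_ofReal.comp hq)
  refine hopen.measure_ne_zero μ ⟨y, hlt⟩ (measure_mono_null (fun z hz => ?_)
    (ae_iff.1 (ae_le_eLpNormEssSup (f := q) (μ := μ))))
  exact not_le.2 (hz.trans_le (Real.ofReal_le_enorm (q z)))

theorem cos_int_odd_mul_pi (k : ℤ) : Real.cos ((2 * k + 1) * π) = -1 := by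
  rw [show (2 * k + 1) * π = π + k * (2 * π) by ring, Real.cos_add_int_mul_two_pi, Real.cos_pi]

theorem exists_abs_sub_int_odd_mul_pi_le (w : ℝ) : ∃ k : ℤ, |w - (2 * k + 1) * π| ≤ π := by
  have hw : w = w / (2 * π) * (2 * π) := by field_simp
  have hle := Int.floor_le (w / (2 * π))
  have hlt := Int.lt_floor_add_one (w / (2 * π))
  refine ⟨⌊w / (2 * π)⌋, abs_le.2 ⟨?_, ?_⟩⟩ <;> nlinarith [Real.pi_pos]

theorem two_mul_one_sub_cos_le (w : ℝ) {k : ℤ} (hw : |w - (2 * k + 1) * π| ≤ π) :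
    2 * (1 - Real.cos w) ≤ 4 - 4 / π ^ 2 * |w - (2 * k + 1) * π| ^ 2 := by
  have hcos : Real.cos w = -Real.cos (w - (2 * k + 1) * π) := by
    rw [← Real.cos_add_pi, ← Real.cos_sub_int_mul_two_pi w k]
    ring_nf
  have hquad := Real.cos_le_one_sub_mul_cos_sq hw
  rw [hcos, sq_abs]
  calc 2 * (1 - -Real.cos (w - (2 * k + 1) * π))
    _ ≤ 2 * (2 - 2 / π ^ 2 * (w - (2 * k + 1) * π) ^ 2) := by linarith
    _ = 4 - 4 / π ^ 2 * (w - (2 * k + 1) * π) ^ 2 := by ring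

theorem two_mul_one_sub_cos_add_mul_le {ψ : ℝ → ℝ} {L : NNReal} {G ε : ℝ}
    (hψ : LipschitzWith L ψ) (hG : ∀ k : ℤ, ψ ((2 * k + 1) * π) ≤ G) (hε : 0 ≤ ε) (w : ℝ) :
    2 * (1 - Real.cos w) + ε * ψ w ≤ 4 + ε * G + L ^ 2 * π ^ 2 / 16 * ε ^ 2 := by
  obtain ⟨k, hk⟩ := exists_abs_sub_int_odd_mul_pi_le w
  set t := |w - (2 * k + 1) * π|
  have hquad : 2 * (1 - Real.cos w) ≤ 4 - 4 / π ^ 2 * t ^ 2 := two_mul_one_sub_cos_le w hk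
  have hlip : ψ w ≤ G + L * t := by
    have h := (le_abs_self _).trans (hψ.dist_le_mul w ((2 * k + 1) * π))
    rw [Real.dist_eq] at h
    linarith [hG k]
  have hsquare : 4 / π ^ 2 * t ^ 2 + L ^ 2 * π ^ 2 / 16 * ε ^ 2 - ε * (L * t) =
      (2 / π * t - ε * L * π / 4) ^ 2 := by
    field_simp
    ring
  nlinarith [mul_le_mul_of_nonneg_left hlip hε, sq_nonneg (2 / π * t - ε * L * π / 4)]

end SpectralPeak

section Triangle

theorem continuous_triangleFun : Continuous triangleFun := by
  unfold triangleFun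
  fun_prop

theorem triangleFun_neg (x : ℝ) : triangleFun (-x) = triangleFun x := by
  rw [triangleFun, triangleFun, abs_neg]

theorem triangleFun_nonneg (x : ℝ) : 0 ≤ triangleFun x :=
  le_max_right _ _

theorem triangleFun_of_mem {x : ℝ} (hx : x ∈ Icc (-1 : ℝ) 1) : triangleFun x = 1 - |x| :=
  max_eq_left (sub_nonneg.2 (abs_le.2 hx))

theorem support_triangleFun_subset : Function.support triangleFun ⊆ Icc (-1) 1 := by
  intro x hx
  rw [mem_Icc, ← abs_le]
  by_contra! h
  exact hx (max_eq_right (by linarith))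

theorem intervalIntegral_eq_two_mul_of_even {g : ℝ → ℝ} {a : ℝ} (heven : ∀ x, g (-x) = g x)
    (hg : IntervalIntegrable g volume 0 a) :
    ∫ x in (-a)..a, g x = 2 * ∫ x in (0 : ℝ)..a, g x := by
  have hreflect : ∫ x in (-a)..0, g x = ∫ x in (0 : ℝ)..a, g x := by
    simpa only [heven, neg_zero] using (intervalIntegral.integral_comp_neg (a := 0) (b := a) g).symm
  have hg' : IntervalIntegrable g volume (-a) 0 := by
    simpa [heven] using ((IntervalIntegrable.iff_comp_neg).1 hg).symm
  rw [← intervalIntegral.integral_add_adjacent_intervals hg' hg, hreflect, two_mul]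

theorem integral_triangleFun_mul_of_even {g : ℝ → ℝ} (heven : ∀ x, g (-x) = g x)
    (hg : Continuous g) :
    ∫ x in (-1 : ℝ)..1, triangleFun x * g x = 2 * ∫ x in (0 : ℝ)..1, (1 - x) * g x := by
  rw [intervalIntegral_eq_two_mul_of_even (g := fun x => triangleFun x * g x)
    (by simp [triangleFun_neg, heven])
    ((continuous_triangleFun.mul hg).intervalIntegrable _ _)]
  congr 1
  refine intervalIntegral.integral_congr fun x hx => ?_
  rw [uIcc_of_le zero_le_one] at hx
  simp only [triangleFun_of_mem ⟨by linarith [hx.1], hx.2⟩, abs_of_nonneg hx.1]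

theorem integral_triangleFun : ∫ x in (-1 : ℝ)..1, triangleFun x = 1 := by
  have h := integral_triangleFun_mul_of_even (g := fun _ => 1) (fun _ => rfl) continuous_const
  simp only [mul_one] at h
  rw [h, intervalIntegral.integral_sub (by simp) (by simp)]
  norm_num

theorem integral_triangleFun_mul_sq : ∫ x in (-1 : ℝ)..1, triangleFun x * x ^ 2 = 1 / 6 := by
  have hpoly (x : ℝ) : (1 - x) * x ^ 2 = x ^ 2 - x ^ 3 := by ring
  rw [integral_triangleFun_mul_of_even (fun x => neg_sq x) (continuous_pow 2)]
  simp_rw [hpoly]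
  rw [intervalIntegral.integral_sub (by simp) (by simp)]
  norm_num

theorem weightedCosTransform_triangleFun (w : ℝ) :
    weightedCosTransform triangleFun w = 2 * (1 - Real.cos w) := by
  have hftc := intervalIntegral.integral_eq_sub_of_hasDerivAt (a := 0) (b := 1)
    (f := fun x => w * ((1 - x) * Real.sin (w * x)) - Real.cos (w * x))
    (f' := fun x => w ^ 2 * ((1 - x) * Real.cos (w * x)))
    (fun x _ => by
      have hw : HasDerivAt (fun x : ℝ => w * x) w x := by
        simpa using (hasDerivAt_id x).const_mul w
      refine (((((hasDerivAt_id x).const_sub 1).mul hw.sin).const_mul w).sub hw.cos).congr_deriv ?_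
      simp only [id]
      ring) (Continuous.intervalIntegrable (by fun_prop) _ _)
  rw [intervalIntegral.integral_const_mul] at hftc
  rw [weightedCosTransform, cosTransform,
    integral_triangleFun_mul_of_even (by simp) (by fun_prop), mul_left_comm, hftc]
  simp [neg_add_eq_sub]

end Triangle

section PerturbedTriangle

/-- The value of `4π² ξ² 𝓕(u₀ + ε f)(ξ)` at `w = 2πξ`, where `u₀` is the triangle function. -/
noncomputable def perturbedProfile (f : ℝ → ℝ) (ε w : ℝ) : ℝ :=
  2 * (1 - Real.cos w) + ε * weightedCosTransform f w

theorem intervalIntegral_triangleFun_add_mul {f g : ℝ → ℝ} (hf : ContinuousOn f (Icc (-1) 1))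
    (hg : Continuous g) (ε : ℝ) :
    ∫ x in (-1 : ℝ)..1, (triangleFun x + ε * f x) * g x =
      (∫ x in (-1 : ℝ)..1, triangleFun x * g x) + ε * ∫ x in (-1 : ℝ)..1, f x * g x := by
  simp_rw [add_mul, mul_assoc]
  rw [intervalIntegral.integral_add (f := fun x => triangleFun x * g x)
      ((continuous_triangleFun.mul hg).intervalIntegrable _ _)
      ((intervalIntegrable_mul_of_continuousOn hf hg).const_mul ε),
    intervalIntegral.integral_const_mul]

theorem weightedCosTransform_triangleFun_add {f : ℝ → ℝ} (hf : ContinuousOn f (Icc (-1) 1))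
    (ε w : ℝ) :
    weightedCosTransform (fun x => triangleFun x + ε * f x) w = perturbedProfile f ε w := by
  rw [perturbedProfile, ← weightedCosTransform_triangleFun, weightedCosTransform, cosTransform,
    intervalIntegral_triangleFun_add_mul hf (by fun_prop)]
  simp only [weightedCosTransform, cosTransform]
  ring

namespace IsC2AdmissiblePerturbation

variable {f : ℝ → ℝ} {ε : ℝ} (hf : IsC2AdmissiblePerturbation f)

include hf

theorem integral_nonneg : 0 ≤ ∫ x in (-1 : ℝ)..1, f x := by
  simpa [hf.fourier_eq_cosTransform, cosTransform] using hf.fourier_re_nonneg 0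

theorem exists_abs_le_mul_triangleFun : ∃ C, ∀ x, |f x| ≤ C * triangleFun x := by
  obtain ⟨C, hC⟩ := hf.contDiffOn.exists_lipschitzOnWith (by simp) (convex_Icc _ _) isCompact_Icc
  refine ⟨C, fun x => ?_⟩
  by_cases hx : x ∈ Icc (-1 : ℝ) 1
  · have habs : |x| ≤ 1 := abs_le.2 hx
    have hfx : f |x| = f x := by
      rcases abs_choice x with h | h <;> rw [h]
      exact hf.even x
    have hlip := hC.dist_le_mul |x| ⟨by linarith [abs_nonneg x], habs⟩ 1 (by simp)
    rwa [Real.dist_eq, Real.dist_eq, hf.exists_weightedCosTransform_eq_neg_cosTransform.1, sub_zero,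
      hfx, abs_sub_comm, abs_of_nonneg (sub_nonneg.2 habs), ← triangleFun_of_mem hx] at hlip
  · rw [Function.notMem_support.1 fun h => hx (hf.support_subset h), abs_zero]
    exact mul_nonneg C.2 (triangleFun_nonneg x)

theorem eventually_triangleFun_add_mul_nonneg :
    ∀ᶠ ε in 𝓝[≥] 0, ∀ x, 0 ≤ triangleFun x + ε * f x := by
  obtain ⟨C, hC⟩ := hf.exists_abs_le_mul_triangleFun
  have hsmall : ∀ᶠ ε in 𝓝[≥] (0 : ℝ), ε * C < 1 :=
    ((continuous_mul_const C).tendsto' 0 0 (zero_mul C)).eventually_lt_const one_pos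
      |>.filter_mono nhdsWithin_le_nhds
  filter_upwards [hsmall, self_mem_nhdsWithin] with ε hεC (hε : 0 ≤ ε) x
  have hbound : |ε * f x| ≤ triangleFun x :=
    calc |ε * f x| = ε * |f x| := by rw [abs_mul, abs_of_nonneg hε]
      _ ≤ ε * C * triangleFun x := by
        rw [mul_assoc]
        exact mul_le_mul_of_nonneg_left (hC x) hε
      _ ≤ triangleFun x := mul_le_of_le_one_left (triangleFun_nonneg x) hεC.le
  linarith [neg_abs_le (ε * f x)]

theorem support_triangleFun_add_mul_subset :
    Function.support (fun x => triangleFun x + ε * f x) ⊆ Icc (-1) 1 :=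
  (Function.support_add _ _).trans (union_subset support_triangleFun_subset
    ((Function.support_mul_subset_right _ _).trans hf.support_subset))

theorem continuousOn_triangleFun_add_mul :
    ContinuousOn (fun x => triangleFun x + ε * f x) (Icc (-1) 1) :=
  continuous_triangleFun.continuousOn.add (hf.continuousOn.const_mul ε)

theorem support_triangleFun_add_mul_mul_subset (g : ℝ → ℝ) :
    Function.support (fun x => (triangleFun x + ε * f x) * g x) ⊆ Icc (-1) 1 :=
  (Function.support_mul_subset_left _ _).trans hf.support_triangleFun_add_mul_subset

theorem integrable_triangleFun_add_mul {g : ℝ → ℝ} (hg : Continuous g) :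
    Integrable fun x => (triangleFun x + ε * f x) * g x := by
  rw [← integrableOn_iff_integrable_of_support_subset (hf.support_triangleFun_add_mul_mul_subset g)]
  exact (hf.continuousOn_triangleFun_add_mul.mul hg.continuousOn).integrableOn_Icc

theorem integral_triangleFun_add_mul {g : ℝ → ℝ} (hg : Continuous g) :
    ∫ x, (triangleFun x + ε * f x) * g x =
      (∫ x in (-1 : ℝ)..1, triangleFun x * g x) + ε * ∫ x in (-1 : ℝ)..1, f x * g x := by
  rw [← intervalIntegral_triangleFun_add_mul hf.continuousOn hg,
    intervalIntegral.integral_of_le (by norm_num), ← integral_Icc_eq_integral_Ioc,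
    setIntegral_eq_integral_of_forall_compl_eq_zero fun x hx => Function.notMem_support.1
      fun h => hx (hf.support_triangleFun_add_mul_mul_subset g h)]

theorem integrable_perturbedTriangle : Integrable (perturbedTriangle f ε) := by
  have hint := hf.integrable_triangleFun_add_mul (ε := ε) (continuous_const (y := 1))
  simp only [mul_one] at hint
  exact hint.ofReal

theorem eLpNorm_perturbedTriangle (hnn : ∀ x, 0 ≤ triangleFun x + ε * f x) :
    eLpNorm (perturbedTriangle f ε) 1 volume =
      ENNReal.ofReal (1 + ε * ∫ x in (-1 : ℝ)..1, f x) := by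
  have hmass := hf.integral_triangleFun_add_mul (ε := ε) (continuous_const (y := 1))
  simp only [mul_one, integral_triangleFun] at hmass
  rw [eLpNorm_one_eq_ofReal_integral_norm hf.integrable_perturbedTriangle, ← hmass]
  simp only [perturbedTriangle, Complex.norm_real, Real.norm_of_nonneg (hnn _)]

theorem secondMomentNorm_perturbedTriangle (hnn : ∀ x, 0 ≤ triangleFun x + ε * f x) :
    secondMomentNorm (perturbedTriangle f ε) =
      ENNReal.ofReal (1 / 6 + ε * ∫ x in (-1 : ℝ)..1, f x * x ^ 2) := by
  have hnorm (x : ℝ) : ‖perturbedTriangle f ε x‖ = triangleFun x + ε * f x := by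
    rw [perturbedTriangle, Complex.norm_real, Real.norm_of_nonneg (hnn x)]
  rw [secondMomentNorm_eq_ofReal (by
    simpa only [hnorm] using hf.integrable_triangleFun_add_mul (continuous_pow 2))]
  simp only [hnorm, hf.integral_triangleFun_add_mul (continuous_pow 2), integral_triangleFun_mul_sq]

theorem norm_fourier_perturbedTriangle_mul_sq (hε : 0 ≤ ε) (ξ : ℝ) :
    ‖𝓕 (perturbedTriangle f ε) ξ‖ * ξ ^ 2 = perturbedProfile f ε (2 * π * ξ) / (4 * π ^ 2) := by
  have hfourier : 𝓕 (perturbedTriangle f ε) ξ =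
      cosTransform (fun x => triangleFun x + ε * f x) (2 * π * ξ) :=
    fourier_ofReal_eq_cosTransform (by simp [triangleFun_neg, hf.even])
      hf.support_triangleFun_add_mul_subset hf.continuousOn_triangleFun_add_mul ξ
  have hprofile : 0 ≤ perturbedProfile f ε (2 * π * ξ) :=
    add_nonneg (by linarith [Real.cos_le_one (2 * π * ξ)])
      (mul_nonneg hε (hf.weightedCosTransform_nonneg _))
  rw [hfourier, Complex.norm_real, Real.norm_eq_abs, eq_div_iff (by positivity),
    ← abs_of_nonneg hprofile, ← weightedCosTransform_triangleFun_add hf.continuousOn,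
    weightedCosTransform, abs_mul, abs_of_nonneg (sq_nonneg (2 * π * ξ))]
  ring

theorem ofReal_le_fourierSecondMomentSup_perturbedTriangle (hε : 0 ≤ ε) (k : ℤ) :
    ENNReal.ofReal ((4 + ε * weightedCosTransform f ((2 * k + 1) * π)) / (4 * π ^ 2)) ≤
      fourierSecondMomentSup (perturbedTriangle f ε) := by
  have hcont : Continuous fun ξ => ‖𝓕 (perturbedTriangle f ε) ξ‖ * ξ ^ 2 :=
    (continuous_fourier hf.integrable_perturbedTriangle).norm.mul (continuous_pow 2)
  have hvalue := ofReal_le_eLpNormEssSup (μ := volume) hcont (k + 1 / 2)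
  rw [hf.norm_fourier_perturbedTriangle_mul_sq hε, perturbedProfile,
    show 2 * π * ((k : ℝ) + 1 / 2) = (2 * k + 1) * π by ring, cos_int_odd_mul_pi] at hvalue
  rw [fourierSecondMomentSup_eq]
  norm_num at hvalue ⊢
  exact hvalue

theorem fourierSecondMomentSup_perturbedTriangle_le {L : NNReal} {G : ℝ}
    (hL : LipschitzWith L (weightedCosTransform f))
    (hG : ∀ k : ℤ, weightedCosTransform f ((2 * k + 1) * π) ≤ G) (hε : 0 ≤ ε) :
    fourierSecondMomentSup (perturbedTriangle f ε) ≤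
      ENNReal.ofReal ((4 + ε * G + L ^ 2 * π ^ 2 / 16 * ε ^ 2) / (4 * π ^ 2)) := by
  rw [fourierSecondMomentSup_eq]
  refine eLpNormEssSup_le_of_ae_enorm_bound (ae_of_all _ fun ξ => ?_)
  rw [Real.enorm_of_nonneg (by positivity), hf.norm_fourier_perturbedTriangle_mul_sq hε]
  gcongr
  exact two_mul_one_sub_cos_add_mul_le hL hG hε _

theorem fourierSecondMomentSup_perturbedTriangle_ne_top (hε : 0 ≤ ε) :
    fourierSecondMomentSup (perturbedTriangle f ε) ≠ ∞ := by
  obtain ⟨L, hL⟩ := hf.exists_lipschitzWith_weightedCosTransform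
  obtain ⟨k, hk⟩ := hf.exists_forall_weightedCosTransform_odd_mul_pi_le
  exact ne_top_of_le_ne_top ENNReal.ofReal_ne_top
    (hf.fourierSecondMomentSup_perturbedTriangle_le hL hk hε)

theorem toReal_fourierSecondMomentSup_perturbedTriangle_zero :
    (fourierSecondMomentSup (perturbedTriangle f 0)).toReal = 1 / π ^ 2 := by
  obtain ⟨L, hL⟩ := hf.exists_lipschitzWith_weightedCosTransform
  obtain ⟨k, hk⟩ := hf.exists_forall_weightedCosTransform_odd_mul_pi_le
  have hupper := hf.fourierSecondMomentSup_perturbedTriangle_le hL hk le_rfl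
  have hlower := hf.ofReal_le_fourierSecondMomentSup_perturbedTriangle le_rfl k
  have hpeak : (4 : ℝ) / (4 * π ^ 2) = 1 / π ^ 2 := by field_simp
  norm_num only [zero_mul, mul_zero, add_zero, hpeak] at hupper hlower
  rw [le_antisymm hupper hlower, ENNReal.toReal_ofReal (by positivity)]

theorem hasDerivWithinAt_fourierSecondMomentSup_perturbedTriangle {k : ℤ}
    (hk : ∀ j : ℤ,
      weightedCosTransform f ((2 * j + 1) * π) ≤ weightedCosTransform f ((2 * k + 1) * π)) :
    HasDerivWithinAt (fun ε => (fourierSecondMomentSup (perturbedTriangle f ε)).toReal)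
      (weightedCosTransform f ((2 * k + 1) * π) / (4 * π ^ 2)) (Ici 0) 0 := by
  obtain ⟨L, hL⟩ := hf.exists_lipschitzWith_weightedCosTransform
  set G := weightedCosTransform f ((2 * k + 1) * π)
  have hG : 0 ≤ G := hf.weightedCosTransform_nonneg _
  have hlower : HasDerivWithinAt (fun ε => (4 + ε * G) / (4 * π ^ 2)) (G / (4 * π ^ 2))
      (Ici 0) 0 := by
    simpa using ((((hasDerivAt_id (0 : ℝ)).mul_const G).const_add 4).div_const
      (4 * π ^ 2)).hasDerivWithinAt
  have hupper : HasDerivWithinAt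
      (fun ε => (4 + ε * G + L ^ 2 * π ^ 2 / 16 * ε ^ 2) / (4 * π ^ 2)) (G / (4 * π ^ 2))
      (Ici 0) 0 := by
    simpa using (((((hasDerivAt_id (0 : ℝ)).mul_const G).const_add 4).add
      ((hasDerivAt_pow 2 (0 : ℝ)).const_mul (L ^ 2 * π ^ 2 / 16))).div_const
      (4 * π ^ 2)).hasDerivWithinAt
  refine hasDerivWithinAt_of_le_of_le hlower hupper (fun ε (hε : 0 ≤ ε) => ?_)
    (fun ε (hε : 0 ≤ ε) => ?_) ?_ ?_
  · exact (ENNReal.ofReal_le_iff_le_toReal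
      (hf.fourierSecondMomentSup_perturbedTriangle_ne_top hε)).1
      (hf.ofReal_le_fourierSecondMomentSup_perturbedTriangle hε k)
  · exact ENNReal.toReal_le_of_le_ofReal (by positivity)
      (hf.fourierSecondMomentSup_perturbedTriangle_le hL hk hε)
  all_goals
    rw [hf.toReal_fourierSecondMomentSup_perturbedTriangle_zero]
    field_simp
    norm_num

end IsC2AdmissiblePerturbation

end PerturbedTriangle

section PerturbationFunctional

namespace IsC2AdmissiblePerturbation

variable {f : ℝ → ℝ} {ε : ℝ} (hf : IsC2AdmissiblePerturbation f)

include hf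

theorem perturbationFunctional_ne_top (hε : 0 ≤ ε) (hnn : ∀ x, 0 ≤ triangleFun x + ε * f x) :
    perturbationFunctional f ε ≠ ∞ := by
  have hmass : 0 < 1 + ε * ∫ x in (-1 : ℝ)..1, f x := by
    linarith [mul_nonneg hε hf.integral_nonneg]
  rw [perturbationFunctional, uncertaintyQuotient, hf.secondMomentNorm_perturbedTriangle hnn,
    hf.eLpNorm_perturbedTriangle hnn]
  exact ENNReal.div_ne_top (ENNReal.mul_ne_top
    (ENNReal.pow_ne_top (hf.fourierSecondMomentSup_perturbedTriangle_ne_top hε))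
    (ENNReal.pow_ne_top ENNReal.ofReal_ne_top)) (pow_ne_zero _ (ENNReal.ofReal_pos.2 hmass).ne')

theorem toReal_perturbationFunctional (hnn : ∀ x, 0 ≤ triangleFun x + ε * f x) :
    (perturbationFunctional f ε).toReal =
      (fourierSecondMomentSup (perturbedTriangle f ε)).toReal ^ 2 *
        (1 / 6 + ε * ∫ x in (-1 : ℝ)..1, f x * x ^ 2) ^ 2 /
        (1 + ε * ∫ x in (-1 : ℝ)..1, f x) ^ 4 := by
  have hmass : 0 ≤ 1 + ε * ∫ x in (-1 : ℝ)..1, f x := by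
    have h := intervalIntegral_triangleFun_add_mul hf.continuousOn (continuous_const (y := 1)) ε
    simp only [mul_one, integral_triangleFun] at h
    exact h ▸ intervalIntegral.integral_nonneg (by norm_num) fun x _ => hnn x
  have hmoment : 0 ≤ 1 / 6 + ε * ∫ x in (-1 : ℝ)..1, f x * x ^ 2 := by
    rw [← integral_triangleFun_mul_sq,
      ← intervalIntegral_triangleFun_add_mul hf.continuousOn (continuous_pow 2)]
    exact intervalIntegral.integral_nonneg (by norm_num) fun x _ =>
      mul_nonneg (hnn x) (sq_nonneg x)
  rw [perturbationFunctional, uncertaintyQuotient, hf.secondMomentNorm_perturbedTriangle hnn,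
    hf.eLpNorm_perturbedTriangle hnn]
  simp only [ENNReal.toReal_div, ENNReal.toReal_mul, ENNReal.toReal_pow,
    ENNReal.toReal_ofReal hmass, ENNReal.toReal_ofReal hmoment]

theorem hasDerivWithinAt_perturbationFunctional {k : ℤ}
    (hk : ∀ j : ℤ,
      weightedCosTransform f ((2 * j + 1) * π) ≤ weightedCosTransform f ((2 * k + 1) * π)) :
    HasDerivWithinAt (fun ε => (perturbationFunctional f ε).toReal)
      (1 / (18 * π ^ 4) * (weightedCosTransform f ((2 * k + 1) * π) / 4 +
        ∫ x in (-1 : ℝ)..1, f x * (6 * x ^ 2 - 2))) (Ici 0) 0 := by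
  set m := ∫ x in (-1 : ℝ)..1, f x
  set n := ∫ x in (-1 : ℝ)..1, f x * x ^ 2
  have hmoments : ∫ x in (-1 : ℝ)..1, f x * (6 * x ^ 2 - 2) = 6 * n - 2 * m := by
    have hint := intervalIntegrable_mul_of_continuousOn hf.continuousOn (continuous_pow 2)
    have hint' := intervalIntegrable_mul_of_continuousOn hf.continuousOn (continuous_const (y := 1))
    simp only [mul_one] at hint'
    rw [← intervalIntegral.integral_const_mul, ← intervalIntegral.integral_const_mul,
      ← intervalIntegral.integral_sub (hint.const_mul 6) (hint'.const_mul 2)]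
    congr with x
    ring
  have hlin (a b : ℝ) : HasDerivWithinAt (fun ε : ℝ => a + ε * b) b (Ici 0) 0 := by
    simpa using (((hasDerivAt_id (0 : ℝ)).mul_const b).const_add a).hasDerivWithinAt
  have hquot := (((hf.hasDerivWithinAt_fourierSecondMomentSup_perturbedTriangle hk).pow 2).mul
    ((hlin (1 / 6) n).pow 2)).div ((hlin 1 m).pow 4) (by simp)
  refine (hquot.congr_of_eventuallyEq_of_mem ?_ self_mem_Ici).congr_deriv ?_
  · filter_upwards [hf.eventually_triangleFun_add_mul_nonneg] with ε hnn
      using hf.toReal_perturbationFunctional hnn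
  · simp only [hf.toReal_fourierSecondMomentSup_perturbedTriangle_zero, hmoments, Pi.pow_apply,
      Pi.mul_apply, zero_mul, add_zero, one_pow, mul_one, div_one, Nat.cast_ofNat,
      Nat.add_one_sub_one, pow_one]
    field_simp
    ring

theorem exists_hasDerivWithinAt_perturbationFunctional_pos (hne : f ≠ 0) :
    ∃ d : ℝ, 0 < d ∧
      HasDerivWithinAt (fun ε => (perturbationFunctional f ε).toReal) d (Ici 0) 0 := by
  obtain ⟨k, hk⟩ := hf.exists_forall_weightedCosTransform_odd_mul_pi_le
  have hpeak (n : ℕ) (hn : Odd n) :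
      weightedCosTransform f (π * n) ≤ weightedCosTransform f ((2 * k + 1) * π) := by
    obtain ⟨j, rfl⟩ := hn
    simpa [mul_comm π] using hk j
  exact ⟨_, mul_pos (by positivity) (hf.quarter_add_integral_pos hne hpeak),
    hf.hasDerivWithinAt_perturbationFunctional hk⟩

theorem eventually_perturbationFunctional_ne_top :
    ∀ᶠ ε in 𝓝[≥] 0, perturbationFunctional f ε ≠ ∞ := by
  filter_upwards [hf.eventually_triangleFun_add_mul_nonneg, self_mem_nhdsWithin] with ε hnn hε
    using hf.perturbationFunctional_ne_top hε hnn

theorem eventually_perturbationFunctional_lt (hne : f ≠ 0) :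
    ∀ᶠ ε in 𝓝[>] 0, perturbationFunctional f 0 < perturbationFunctional f ε := by
  obtain ⟨d, hd, hderiv⟩ := hf.exists_hasDerivWithinAt_perturbationFunctional_pos hne
  have hfinite := hf.eventually_perturbationFunctional_ne_top
  filter_upwards [eventually_lt_of_hasDerivWithinAt_Ici_pos hderiv hd,
    hfinite.filter_mono (nhdsWithin_mono 0 Ioi_subset_Ici_self)] with ε hlt hε
  exact (ENNReal.toReal_lt_toReal (hfinite.self_of_nhdsWithin self_mem_Ici) hε).1 hlt

end IsC2AdmissiblePerturbation

end PerturbationFunctional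

theorem theorem7_general :
    (∃ c : ℝ, 0 < c ∧ ∀ u : ℝ → ℂ, Integrable u volume →
      ENNReal.ofReal c * eLpNorm u 1 volume ^ 4 ≤
        fourierSecondMomentSup u ^ 2 * secondMomentNorm u ^ 2) ∧
    (∀ f : ℝ → ℝ, IsC2AdmissiblePerturbation f → f ≠ 0 →
      (∃ ε₀ : ℝ, 0 < ε₀ ∧ ∀ ε ∈ Icc 0 ε₀, perturbationFunctional f ε ≠ ∞) ∧
      (∃ d : ℝ, 0 < d ∧
        HasDerivWithinAt (fun ε : ℝ => (perturbationFunctional f ε).toReal) d (Ici 0) 0) ∧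
      (∃ ε₀ : ℝ, 0 < ε₀ ∧ ∀ ε ∈ Ioc 0 ε₀,
        perturbationFunctional f 0 < perturbationFunctional f ε)) := by
  refine ⟨⟨1 / (128 * π ^ 2) ^ 2, by positivity, fun u hu => eLpNorm_one_pow_four_le hu⟩,
    fun f hf hne => ⟨?_, hf.exists_hasDerivWithinAt_perturbationFunctional_pos hne, ?_⟩⟩
  · exact mem_nhdsGE_iff_exists_Icc_subset.1 hf.eventually_perturbationFunctional_ne_top
  · exact mem_nhdsGT_iff_exists_Ioc_subset.1 (hf.eventually_perturbationFunctional_lt hne)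

theorem theorem7 :
    (∃ c : ℝ, 0 < c ∧ ∀ u : ℝ → ℂ, Integrable u volume →
      ENNReal.ofReal c * eLpNorm u 1 volume ^ 4 ≤
        fourierSecondMomentSup u ^ 2 * secondMomentNorm u ^ 2) ∧
    (∀ f : ℝ → ℝ, IsAdmissiblePerturbation f → f ≠ 0 →
      (∃ ε₀ : ℝ, 0 < ε₀ ∧ ∀ ε ∈ Icc 0 ε₀, perturbationFunctional f ε ≠ ∞) ∧
      (∃ d : ℝ, 0 < d ∧
        HasDerivWithinAt (fun ε : ℝ => (perturbationFunctional f ε).toReal) d (Ici 0) 0) ∧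
      (∃ ε₀ : ℝ, 0 < ε₀ ∧ ∀ ε ∈ Ioc 0 ε₀,
        perturbationFunctional f 0 < perturbationFunctional f ε)) := by
  exact ⟨theorem7_general.1, fun f hf hne =>
    theorem7_general.2 f hf.isC2AdmissiblePerturbation hne⟩
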